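/- Consider a power network with buses $1,\dots,n_b$ and branches $1,\dots,n$, where branch $b$ joins two distinct buses $i_b,j_b$; let $A\in\mathbb R^{n\times n_b}$ be its branch-bus incidence matrix and $\mathcal E$ the set of pairs of buses joined by a branch. For $Y\in\mathbb R^n$ and buses $i,j$ put $$\mathcal F_{ij}(Y)=e_i^TA^T\mathrm{diag}(Y)Ae_j\,(e_i-e_j)^T\big(A^T\mathrm{diag}(Y)A\big)^{-1^*},$$ where $M^{-1^*}$ is obtained from the nodal admittance matrix $M$ by deleting the rows and columns of the reference buses (the first bus of each connected subnetwork), inverting, and filling these rows and columns with zeros. For a parameter $s$ and line thresholds $c_b$ let $g(p,c)=0$ if $|p|\ge\sqrt{c^2+\pi/(2s)}$, $g(p,c)=1$ if $|p|\le\sqrt{c^2-\pi/(2s)}$, and $g(p,c)=\frac12\big(1-\sin s(p^2-c^2)\big)$ otherwise. Let $P^0\in\mathbb R^{n_b}$ be the original injected power, $Y^0_p$ the original branch admittances, $\delta$ a disturbance, $Y^1_p=Y^0_p+\delta$ and $(Y_p^{k+1})_b=g(\mathcal F_{i_bj_b}(Y_p^k)P^0,c_b)\,(Y_p^k)_b$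 for $k\ge1$. Fix $m\ge2$. Let $$R^{m-1}_{ij}=\sum_{b}\frac{\partial\,[\mathcal F_{ij}(Y)P^0]}{\partial Y_b}\Big|_{Y=Y_p^m}\; \frac{\partial g}{\partial p}\big(\mathcal F_{i_bj_b}(Y_p^{m-1})P^0,c_b\big)\,(Y_p^{m-1})_b\;\mathcal F_{i_bj_b}(Y_p^{m-1})^T,\qquad R^m_{ij}=\mathcal F_{ij}(Y_p^m)^T,$$ and let $\hat P^m_{ij}=(R^{m-1}_{ij})^T(P^{m-1}-P^0)+(R^m_{ij})^TP^m$ be the linearized transmission power. With weights $W\in\mathbb R^{n_b}$, thresholds $\sigma_{ij}$ and bounds $\underline P,\bar P\in\mathbb R^{n_b}$, the linearized two-step recurring problem is to minimize $$\mathcal C(P^{m-1},P^m)=\|W\circ(P^{m-1}-P^0)\|^2+\|W\circ(P^m-P^0)\|^2$$ over $P^{m-1},P^m\in\mathbb R^{n_b}$ subject to $(\hat P^m_{ij})^2\le\sigma_{ij}^2$ for $(i,j)\in\mathcal E$ and $\underline P_i\le P^k_i\le\bar P_i$ for all $i$ and $k\in\{m-1,m\}$. Its Lagrangian is $$L=\mathcal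 C+\sum_{k,i}\bar\tau^k_i(P^k_i-\bar P_i)+\sum_{k,i}\underline\tau^k_i(\underline P_i-P^k_i)+\sum_{(i,j)\in\mathcal E}\lambda_{ij}\big[(\hat P^m_{ij})^2-\sigma_{ij}^2\big],$$ and its saddle-point dynamics, on the states with $\lambda,\bar\tau,\underline\tau\ge0$, are $$\dot P^k=-\nabla_{P^k}L,\quad \dot\lambda_{ij}=\big[(\hat P^m_{ij})^2-\sigma_{ij}^2\big]^+_{\lambda_{ij}},\quad \dot{\bar\tau}^k_i=\big[P^k_i-\bar P_i\big]^+_{\bar\tau^k_i},\quad \dot{\underline\tau}^k_i=\big[\underline P_i-P^k_i\big]^+_{\underline\tau^k_i},$$ where $[x]^+_y=x$ if $y>0$ and $[x]^+_y=\max\{x,0\}$ if $y=0$. Solutions are understood in the sense of Carathéodory on $[0,\infty)$ (locally absolutely continuous, satisfying the equations at almost every time). Proposition 7. Suppose that $W_i\ne0$ for all $i$, that $\sigma_{ij}>0$ for all $(i,j)\in\mathcal E$, and that the feasible region of the problem is nonempty. Then the problem has exactly one optimal solution $P^*=(P^{m-1*},P^{m*})$, and there are multipliers $(\lambda^*,\tau^*)$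 such that $(P^*,\lambda^*,\tau^*)$ is a saddle point of $L$ (over all $P$ and all nonnegative multipliers). Every such saddle point is Lyapunov stable for the saddle-point dynamics. Every solution of the saddle-point dynamics, from any initial state with nonnegative multipliers, converges as $t\to\infty$ to some saddle point $(P^*,\lambda^*,\tau^*)$ of $L$; in particular $P^{m-1}(t)\to P^{m-1*}$ and $P^m(t)\to P^{m*}$. -/

import Mathlib

open Set Filter Topology MeasureTheory
open scoped Matrix

noncomputable section

/-- Buses `i` and `j` are joined directly when the corresponding off-diagonal entry of the nodal
admittance matrix is nonzero; the connected components of this graph are the subnetworks. -/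
def nodalGraph {nb : ℕ} (M : Matrix (Fin nb) (Fin nb) ℝ) : SimpleGraph (Fin nb) :=
  SimpleGraph.fromRel fun i j => M i j ≠ 0

/-- The first bus of each subnetwork is its reference bus (voltage angle zero). -/
def IsReferenceBus {nb : ℕ} (M : Matrix (Fin nb) (Fin nb) ℝ) (i : Fin nb) : Prop :=
  ∀ j, (nodalGraph M).Reachable i j → i ≤ j

open Classical in
/-- The inverse of a nodal admittance matrix used for the DC power flow: the rows and columns of the
reference buses are deleted, the remaining matrix (block diagonal along the subnetworks) is
inverted, and the rows and columns of the reference buses are filled with zeros.  Thus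
`starInv M *ᵥ P` is the vector of voltage angles that vanishes at the reference buses. -/
def starInv {nb : ℕ} (M : Matrix (Fin nb) (Fin nb) ℝ) : Matrix (Fin nb) (Fin nb) ℝ :=
  fun i j =>
    if h : ¬ IsReferenceBus M i ∧ ¬ IsReferenceBus M j then
      (M.submatrix (Subtype.val : {k // ¬ IsReferenceBus M k} → Fin nb)
          (Subtype.val : {k // ¬ IsReferenceBus M k} → Fin nb))⁻¹
        ⟨i, h.1⟩ ⟨j, h.2⟩
    else 0

open Classical in
/-- The smoothed line-outage function with tunable parameter `s` and line threshold `c`. -/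
def outage (s p c : ℝ) : ℝ :=
  if Real.sqrt (c ^ 2 + Real.pi / (2 * s)) ≤ |p| then 0
  else if |p| ≤ Real.sqrt (c ^ 2 - Real.pi / (2 * s)) then 1
  else (1 - Real.sin (s * (p ^ 2 - c ^ 2))) / 2

open Classical in
/-- The switching operator `[x]⁺_y` (used for `0 ≤ y`). -/
def switchPlus (x y : ℝ) : ℝ := if 0 < y then x else max x 0

/-- The data of the two-step protection problem: a power network with buses `Fin nb` and branches
`Fin n`, its original branch admittances and their initial disturbance, the parameters of the outage
model, and the data of the load shedding problem. -/
structure PowerNetwork (nb n : ℕ) where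
  /-- the two end buses of each branch -/
  src : Fin n → Fin nb
  tgt : Fin n → Fin nb
  src_ne_tgt : ∀ b, src b ≠ tgt b
  /-- original branch admittances and disturbance -/
  Y0 : Fin n → ℝ
  disturb : Fin n → ℝ
  /-- tunable parameter and line thresholds of the outage function -/
  s : ℝ
  c : Fin n → ℝ
  /-- original injected power and bus weights -/
  P0 : EuclideanSpace ℝ (Fin nb)
  W : Fin nb → ℝ
  /-- lower and upper bounds of the injected power -/
  Plo : Fin nb → ℝ
  Phi : Fin nb → ℝ
  /-- transmission power thresholds imposed at the final step -/
  thr : Fin nb → Fin nb → ℝ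

namespace PowerNetwork

variable {nb n : ℕ} (N : PowerNetwork nb n)

/-- Branch-bus incidence matrix. -/
def A : Matrix (Fin n) (Fin nb) ℝ := fun b i =>
  if i = N.src b then 1 else if i = N.tgt b then -1 else 0

/-- Nodal admittance matrix `Aᵀ diag(Y) A`. -/
def nodal (Y : Fin n → ℝ) : Matrix (Fin nb) (Fin nb) ℝ := N.Aᵀ * Matrix.diagonal Y * N.A

/-- The row vector `e_iᵀ Aᵀ diag(Y) A e_j (e_i - e_j)ᵀ (Aᵀ diag(Y) A)^{-1*}`. -/
def F (Y : Fin n → ℝ) (i j : Fin nb) : Fin nb → ℝ :=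
  N.nodal Y i j • ((Pi.single i 1 - Pi.single j 1) ᵥ* starInv (N.nodal Y))

/-- Transmission power on branch `b` for admittances `Y` and injected power `P`. -/
def branchFlow (Y : Fin n → ℝ) (P : EuclideanSpace ℝ (Fin nb)) (b : Fin n) : ℝ :=
  N.F Y (N.src b) (N.tgt b) ⬝ᵥ P.ofLp

/-- One cascading step `Y ↦ 𝒢(P_{ij}) ∘ Y` with injected power `P`. -/
def step (Y : Fin n → ℝ) (P : EuclideanSpace ℝ (Fin nb)) : Fin n → ℝ := fun b =>
  outage N.s (N.branchFlow Y P b) (N.c b) * Y b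

/-- Branch admittance at the `k`-th cascading step when the injected power stays at `P0`. -/
def Yp : ℕ → Fin n → ℝ
  | 0 => N.Y0
  | 1 => N.Y0 + N.disturb
  | k + 2 => N.step (Yp (k + 1)) N.P0

/-- The admittance `Y_p^m|_{P0} = 𝒢(ℱ(Y_p^{m-1}) P0) ∘ Y_p^{m-1}`. -/
def YmAtP0 (m : ℕ) : Fin n → ℝ := N.step (N.Yp (m - 1)) N.P0

/-- The gradients `R_{ij}^k` of the linearized transmission power; `k = 0` stands for the step
`m - 1` and `k = 1` for the step `m`.  The first one is the chain-rule expression: for each branch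
`b`, the partial derivative of `ℱ_{ij}(Y) P0` in `Y_b` at `Y_p^m|_{P0}`, times the derivative of the
outage function at the flow of `b`, times `Y_b^{m-1}`, times the row vector of the flow on `b`. -/
def R (m : ℕ) (k : Fin 2) (i j : Fin nb) : Fin nb → ℝ :=
  if k = 0 then
    ∑ b : Fin n,
      (deriv (fun y => N.F (Function.update (N.YmAtP0 m) b y) i j ⬝ᵥ N.P0.ofLp) (N.YmAtP0 m b) *
        (deriv (fun p => outage N.s p (N.c b)) (N.branchFlow (N.Yp (m - 1)) N.P0 b) *
          N.Yp (m - 1) b)) •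
        N.F (N.Yp (m - 1)) (N.src b) (N.tgt b)
  else N.F (N.YmAtP0 m) i j

/-- The decision variables: `P 0` is `P^{m-1}` and `P 1` is `P^m`. -/
abbrev Power (nb : ℕ) : Type := Fin 2 → EuclideanSpace ℝ (Fin nb)

/-- The linearized transmission power `P̂_{ij}^m` as a function of `(P^{m-1}, P^m)`. -/
def Phat (m : ℕ) (i j : Fin nb) (P : Power nb) : ℝ :=
  N.R m 0 i j ⬝ᵥ (P 0 - N.P0).ofLp + N.R m 1 i j ⬝ᵥ (P 1).ofLp

/-- The set `ℰ` of pairs of buses joined by a branch. -/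
abbrev Edge : Type := {e : Fin nb × Fin nb //
  ∃ b, (N.src b = e.1 ∧ N.tgt b = e.2) ∨ (N.src b = e.2 ∧ N.tgt b = e.1)}

/-- `‖W ∘ (P^{m-1} - P0)‖² + ‖W ∘ (P^m - P0)‖²`. -/
def cost (P : Power nb) : ℝ :=
  ∑ k, ‖WithLp.toLp 2 fun i => N.W i * (P k - N.P0) i‖ ^ 2

/-- The feasible region of the linearized two-step problem. -/
def feasible (m : ℕ) : Set (Power nb) :=
  {P | (∀ e : N.Edge, N.Phat m e.1.1 e.1.2 P ^ 2 ≤ N.thr e.1.1 e.1.2 ^ 2) ∧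
    ∀ k i, N.Plo i ≤ P k i ∧ P k i ≤ N.Phi i}

/-- Optimal solutions of the linearized two-step problem. -/
def IsOptimal (m : ℕ) (P : Power nb) : Prop :=
  P ∈ N.feasible m ∧ ∀ Q ∈ N.feasible m, N.cost P ≤ N.cost Q

/-- The multipliers `(λ, τ̄, τ̲)`. -/
abbrev Multiplier : Type :=
  (N.Edge → ℝ) × (Fin 2 → Fin nb → ℝ) × (Fin 2 → Fin nb → ℝ)

/-- The Lagrangian. -/
def lagrangian (m : ℕ) (P : Power nb) (μ : N.Multiplier) : ℝ :=
  N.cost P + ∑ k, ∑ i, μ.2.1 k i * (P k i - N.Phi i) + ∑ k, ∑ i, μ.2.2 k i * (N.Plo i - P k i) +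
    ∑ e : N.Edge, μ.1 e * (N.Phat m e.1.1 e.1.2 P ^ 2 - N.thr e.1.1 e.1.2 ^ 2)

/-- Saddle points of the Lagrangian over all powers and all nonnegative multipliers. -/
def IsSaddlePoint (m : ℕ) (P : Power nb) (μ : N.Multiplier) : Prop :=
  0 ≤ μ ∧ (∀ Q, N.lagrangian m P μ ≤ N.lagrangian m Q μ) ∧
    ∀ ν, 0 ≤ ν → N.lagrangian m P ν ≤ N.lagrangian m P μ

/-- The states of the saddle-point dynamics. -/
abbrev State : Type := Power nb × N.Multiplier

/-- The right-hand side of the saddle-point dynamics. -/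
def field (m : ℕ) (z : N.State) : N.State :=
  (fun k => -gradient (fun p => N.lagrangian m (Function.update z.1 k p) z.2) (z.1 k),
    fun e => switchPlus (N.Phat m e.1.1 e.1.2 z.1 ^ 2 - N.thr e.1.1 e.1.2 ^ 2) (z.2.1 e),
    fun k i => switchPlus (z.1 k i - N.Phi i) (z.2.2.1 k i),
    fun k i => switchPlus (N.Plo i - z.1 k i) (z.2.2.2 k i))

/-- Carathéodory solutions on `[0, ∞)` of the saddle-point dynamics (its right-hand side is
discontinuous): locally absolutely continuous curves with nonnegative multipliers that satisfy the
differential equation at almost every time. -/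
structure IsSolution (m : ℕ) (z : ℝ → N.State) : Prop where
  absCont : ∀ T, 0 ≤ T → AbsolutelyContinuousOnInterval z 0 T
  nonneg : ∀ t, 0 ≤ t → 0 ≤ (z t).2
  hasDeriv : ∀ᵐ t ∂volume, 0 < t → HasDerivAt z (N.field m (z t)) t

end PowerNetwork

end

/-!
The problem is a convex program with strictly convex objective and compact feasible region, so it
has a unique optimum. Its constraints are affine, or bounds on squares of affine functions by
positive constants, so that a direction in which no active constraint increases to first order
remains feasible for a short time; Farkas' lemma then gives multipliers without a Slater point.

Along a solution of the saddle-point dynamics, the squared distance to a saddle point `(P*, λ*)`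
decreases at a rate of at least `2 (L(P, λ*) - L(P*, λ))`. This yields stability, and by Barbalat's
argument it forces `L(P', λ*) = L(P*, λ*) = L(P*, λ')` at every cluster point `(P', λ')` as
`t → ∞`. Strict convexity gives `P' = P*`. Hence the primal part converges, its velocity
`-∇L(·, λ')` vanishes at the cluster points, and every cluster point is a saddle point. Since the
distance to that saddle point is again nonincreasing, the whole solution converges to it.
-/

theorem strictConvexOn_norm_sq {E : Type*} [NormedAddCommGroup E] [InnerProductSpace ℝ E] :
    StrictConvexOn ℝ univ fun x : E => ‖x‖ ^ 2 := by
  refine StrongConvexOn.strictConvexOn (m := 2) (strongConvexOn_iff_convex.2 ?_) two_pos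
  simpa using convexOn_const 0 convex_univ

theorem strictConvexOn_norm_map_sub_sq {E E' : Type*} [AddCommGroup E] [Module ℝ E]
    [NormedAddCommGroup E'] [InnerProductSpace ℝ E'] {T : E →ₗ[ℝ] E'} (hT : Function.Injective T)
    (c : E) : StrictConvexOn ℝ univ fun x => ‖T (x - c)‖ ^ 2 := by
  refine ⟨convex_univ, fun x _ y _ hxy a b ha hb hab => ?_⟩
  have hcomb : T (a • x + b • y - c) = a • T (x - c) + b • T (y - c) := by
    rw [← map_smul, ← map_smul, ← map_add, smul_sub, smul_sub, sub_add_sub_comm, ← add_smul, hab,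
      one_smul]
  simpa only [hcomb] using strictConvexOn_norm_sq.2 (mem_univ (T (x - c))) (mem_univ (T (y - c)))
    (hT.ne fun h => hxy (sub_left_injective h)) ha hb hab

theorem convexOn_norm_map_sub_sq {E E' : Type*} [AddCommGroup E] [Module ℝ E]
    [SeminormedAddCommGroup E'] [NormedSpace ℝ E'] (T : E →ₗ[ℝ] E') (c : E) :
    ConvexOn ℝ univ fun x => ‖T (x - c)‖ ^ 2 :=
  (convexOn_univ_norm.pow (fun _ _ => norm_nonneg _) 2).comp_affineMap
    (T.toAffineMap.comp (AffineMap.id ℝ E - AffineMap.const ℝ E c))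

theorem convexOn_add_const_sq {E : Type*} [AddCommGroup E] [Module ℝ E] (ℓ : E →ₗ[ℝ] ℝ) (c : ℝ) :
    ConvexOn ℝ univ fun x => (ℓ x + c) ^ 2 :=
  even_two.convexOn_pow.comp_affineMap (ℓ.toAffineMap + AffineMap.const ℝ E c)

theorem eventually_add_mul_sq_le_sq {a b : ℝ} (ha : a ≠ 0) (hab : a * b ≤ 0) :
    ∀ᶠ t : ℝ in 𝓝[>] 0, (a + t * b) ^ 2 ≤ a ^ 2 := by
  rcases eq_or_ne b 0 with rfl | hb
  · simp
  have hlt : a * b < 0 := hab.lt_of_ne (mul_ne_zero ha hb)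
  have hlim : Tendsto (fun t : ℝ => 2 * (a * b) + t * b ^ 2) (𝓝[>] 0) (𝓝 (2 * (a * b))) :=
    ((by fun_prop : Continuous fun t : ℝ => 2 * (a * b) + t * b ^ 2).tendsto' 0 _
      (by simp)).mono_left nhdsWithin_le_nhds
  filter_upwards [hlim.eventually (ge_mem_nhds (mul_neg_of_pos_of_neg two_pos hlt)),
    self_mem_nhdsWithin] with t ht ht0
  linear_combination mul_nonpos_of_nonneg_of_nonpos (mem_Ioi.1 ht0).le ht

section ConstraintQualification

variable {E : Type*} [NormedAddCommGroup E] [NormedSpace ℝ E] {ℓ : E →L[ℝ] ℝ} {c : ℝ} {x d : E}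

theorem eventually_affine_nonpos (hx : ℓ x + c = 0) (hd : fderiv ℝ (fun x => ℓ x + c) x d ≤ 0) :
    ∀ᶠ t : ℝ in 𝓝[>] 0, ℓ (x + t • d) + c ≤ 0 := by
  rw [fderiv_add_const, ContinuousLinearMap.fderiv] at hd
  filter_upwards [self_mem_nhdsWithin] with t ht
  rw [map_add, map_smul, smul_eq_mul]
  linear_combination hx + mul_nonpos_of_nonneg_of_nonpos (mem_Ioi.1 ht).le hd

theorem eventually_affine_sq_sub_sq_nonpos {σ : ℝ} (hσ : σ ≠ 0) (hx : (ℓ x + c) ^ 2 - σ ^ 2 = 0)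
    (hd : fderiv ℝ (fun x => (ℓ x + c) ^ 2 - σ ^ 2) x d ≤ 0) :
    ∀ᶠ t : ℝ in 𝓝[>] 0, (ℓ (x + t • d) + c) ^ 2 - σ ^ 2 ≤ 0 := by
  have hfderiv : fderiv ℝ (fun x => (ℓ x + c) ^ 2 - σ ^ 2) x d = 2 * ((ℓ x + c) * ℓ d) := by
    rw [(((ℓ.hasFDerivAt.add_const c).pow 2).sub_const (σ ^ 2)).fderiv]
    simp only [Nat.add_one_sub_one, pow_one, smul_add, nsmul_eq_mul, Nat.cast_ofNat, smul_apply,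
      smul_eq_mul]
    ring
  have hne : ℓ x + c ≠ 0 := pow_ne_zero_iff two_ne_zero |>.1 <|
    sub_eq_zero.1 hx ▸ pow_ne_zero 2 hσ
  filter_upwards [eventually_add_mul_sq_le_sq hne (b := ℓ d) (by linarith)] with t ht
  rw [map_add, map_smul, smul_eq_mul, add_right_comm]
  exact (sub_le_sub_right ht _).trans_eq hx

end ConstraintQualification

section Gradient

variable {ι : Type*} [Fintype ι] [DecidableEq ι] {E : ι → Type*} [∀ i, NormedAddCommGroup (E i)]
  [∀ i, InnerProductSpace ℝ (E i)]

theorem inner_piLp_single_right (x : PiLp 2 E) (i : ι) (v : E i) :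
    inner ℝ x (PiLp.single 2 i v) = inner ℝ (x i) v := by
  rw [PiLp.inner_apply, Finset.sum_eq_single_of_mem i (Finset.mem_univ i) fun j _ hj => by
    rw [PiLp.single_eq_of_ne 2 hj, inner_zero_right], PiLp.single_eq_same]

theorem gradient_comp_update [∀ i, CompleteSpace (E i)] {f : PiLp 2 E → ℝ} {x : PiLp 2 E}
    (hf : DifferentiableAt ℝ f x) (i : ι) :
    gradient (fun v => f (WithLp.toLp 2 (Function.update x.ofLp i v))) (x i) = gradient f x i := by
  have hupdate := (PiLp.continuousLinearEquiv 2 ℝ E).symm.hasFDerivAt.comp (x i)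
    (hasFDerivAt_update x.ofLp (x i))
  have hcomp := HasFDerivAt.comp (g := f) (g' := fderiv ℝ f x) (x i)
    (by simpa using hf.hasFDerivAt) hupdate
  refine ext_inner_right ℝ fun v => ?_
  rw [inner_gradient_left, ← inner_piLp_single_right, inner_gradient_left]
  refine (congrArg (fun L => L v) hcomp.fderiv).trans (congrArg (fderiv ℝ f x) ?_)
  ext j
  rcases eq_or_ne j i with rfl | hj
  · simp
  · simp [hj]

end Gradient

section Farkas

variable {V κ : Type*} [AddCommGroup V] [Module ℝ V]

/- Induction on the number of functionals. If `a k₀` cannot be omitted, it is positive at some `d`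
at which `v` is positive and the other functionals are nonpositive; subtracting multiples of `a k₀`
from `v` and the other functionals to make them vanish at `d` eliminates `a k₀`. -/
theorem mem_hull_image_of_forall_nonpos (s : Finset κ) (a : κ → Module.Dual ℝ V)
    (v : Module.Dual ℝ V) (h : ∀ d, (∀ k ∈ s, a k d ≤ 0) → v d ≤ 0) :
    v ∈ PointedCone.hull ℝ (a '' s) := by
  classical
  induction s using Finset.induction_on generalizing a v with
  | empty =>
    have hv : v = 0 := LinearMap.ext fun d =>
      le_antisymm (h d (by simp)) (by simpa using h (-d) (by simp))
    exact hv ▸ zero_mem _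
  | insert k₀ s _ ih =>
    rw [Finset.coe_insert, image_insert_eq]
    by_cases hs : ∀ d, (∀ k ∈ s, a k d ≤ 0) → v d ≤ 0
    · exact Submodule.span_mono (subset_insert _ _) (ih a v hs)
    push Not at hs
    obtain ⟨d, hd, hvd⟩ := hs
    have hpos : 0 < a k₀ d := by
      by_contra! hle
      exact hvd.not_ge (h d (Finset.forall_mem_insert _ _ _ |>.2 ⟨hle, hd⟩))
    let reduce (f : Module.Dual ℝ V) : Module.Dual ℝ V := f - (f d / a k₀ d) • a k₀
    have hreduce : ∀ f x, reduce f x = f (x - (a k₀ x / a k₀ d) • d) := fun f x => by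
      simp only [reduce, LinearMap.sub_apply, LinearMap.smul_apply, smul_eq_mul, map_sub, map_smul]
      ring
    have hmem : reduce v ∈ PointedCone.hull ℝ ((fun k => reduce (a k)) '' s) := by
      refine ih _ _ fun x hx => ?_
      rw [hreduce]
      refine h _ (Finset.forall_mem_insert _ _ _ |>.2 ⟨?_, fun k hk => hreduce (a k) x ▸ hx k hk⟩)
      simp [hpos.ne']
    have hsmul : ∀ c : ℝ, 0 ≤ c → c • a k₀ ∈ PointedCone.hull ℝ (insert (a k₀) (a '' s)) :=
      fun c hc => Submodule.smul_mem _ (⟨c, hc⟩ : {c : ℝ // 0 ≤ c})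
        (Submodule.subset_span (mem_insert _ _))
    have hreduce_mem : ∀ k ∈ s,
        reduce (a k) ∈ PointedCone.hull ℝ (insert (a k₀) (a '' s)) := fun k hk => by
      have hcoef : 0 ≤ -(a k d / a k₀ d) :=
        neg_nonneg.2 (div_nonpos_of_nonpos_of_nonneg (hd k hk) hpos.le)
      rw [show reduce (a k) = a k + -(a k d / a k₀ d) • a k₀ by simp only [reduce]; module]
      exact add_mem (Submodule.subset_span (mem_insert_of_mem _ (mem_image_of_mem a hk)))
        (hsmul _ hcoef)
    have hle : PointedCone.hull ℝ ((fun k => reduce (a k)) '' s) ≤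
        PointedCone.hull ℝ (insert (a k₀) (a '' s)) :=
      Submodule.span_le.2 (image_subset_iff.2 hreduce_mem)
    simpa [reduce] using add_mem (hle hmem) (hsmul (v d / a k₀ d) (by positivity))

/-- **Farkas' lemma** for finitely many linear functionals. -/
theorem exists_nonneg_sum_smul_eq_of_forall_nonpos [Fintype κ] (s : Finset κ)
    (a : κ → Module.Dual ℝ V) (v : Module.Dual ℝ V)
    (h : ∀ d, (∀ k ∈ s, a k d ≤ 0) → v d ≤ 0) :
    ∃ y : κ → ℝ, 0 ≤ y ∧ (∀ k ∉ s, y k = 0) ∧ ∑ k, y k • a k = v := by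
  classical
  obtain ⟨c, rfl⟩ := Submodule.mem_span_image_finset_iff_exists_fun' _ |>.1
    (mem_hull_image_of_forall_nonpos s a v h)
  refine ⟨fun k => if k ∈ s then c k else 0, fun k => ?_, fun k hk => if_neg hk, ?_⟩
  · by_cases hk : k ∈ s <;> simp [hk, (c k).2]
  · simp [ite_smul, Finset.sum_ite_mem]

end Farkas

theorem add_fderiv_sub_le_of_convexOn {E : Type*} [NormedAddCommGroup E] [NormedSpace ℝ E]
    {f : E → ℝ} (hf : ConvexOn ℝ univ f) {x : E} (hfx : DifferentiableAt ℝ f x) (y : E) :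
    f x + fderiv ℝ f x (y - x) ≤ f y := by
  have hline : ConvexOn ℝ univ (f ∘ AffineMap.lineMap (k := ℝ) x y) := hf.comp_affineMap _
  have hder : HasDerivAt (f ∘ AffineMap.lineMap (k := ℝ) x y) (fderiv ℝ f x (y - x)) 0 :=
    HasFDerivAt.comp_hasDerivAt (0 : ℝ) (by simpa using hfx.hasFDerivAt)
      AffineMap.hasDerivAt_lineMap
  have hslope := hline.le_slope_of_hasDerivAt (mem_univ 0) (mem_univ 1) zero_lt_one hder
  rw [slope_def_field] at hslope
  simp only [Function.comp_apply, AffineMap.lineMap_apply_one, AffineMap.lineMap_apply_zero,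
    sub_zero, div_one] at hslope
  linarith

/-- Minimization of a smooth convex function `objective` subject to the smooth convex constraints
`constraint j x ≤ 0`. -/
structure ConvexProgram (E J : Type*) [NormedAddCommGroup E] [NormedSpace ℝ E] where
  objective : E → ℝ
  constraint : J → E → ℝ
  contDiff_objective : ContDiff ℝ 1 objective
  contDiff_constraint : ∀ j, ContDiff ℝ 1 (constraint j)
  convexOn_objective : ConvexOn ℝ univ objective
  convexOn_constraint : ∀ j, ConvexOn ℝ univ (constraint j)

namespace ConvexProgram

section Multipliers

variable {E J : Type*} [NormedAddCommGroup E] [NormedSpace ℝ E] (p : ConvexProgram E J)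

/-- The points that satisfy all constraints of a convex program. -/
def feasibleSet : Set E := {x | ∀ j, p.constraint j x ≤ 0}

theorem isClosed_feasibleSet : IsClosed p.feasibleSet := by
  simp only [feasibleSet, ofPred_forall]
  exact isClosed_iInter fun j =>
    isClosed_le (p.contDiff_constraint j).continuous continuous_const

theorem convex_feasibleSet : Convex ℝ p.feasibleSet := by
  simp only [feasibleSet, ofPred_forall]
  exact convex_iInter fun j => by simpa using (p.convexOn_constraint j).convex_le 0

/-- The constraint qualification at `x` that every direction in which no active constraint
increases to first order keeps the active constraints satisfied for short steps. -/
def IsQualified (x : E) : Prop :=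
  ∀ j d, p.constraint j x = 0 → fderiv ℝ (p.constraint j) x d ≤ 0 →
    ∀ᶠ t : ℝ in 𝓝[>] 0, p.constraint j (x + t • d) ≤ 0

variable {p} in
theorem fderiv_objective_nonneg {x d : E} [Finite J] (hx : x ∈ p.feasibleSet)
    (hmin : IsMinOn p.objective p.feasibleSet x) (hq : p.IsQualified x)
    (hd : ∀ j, p.constraint j x = 0 → fderiv ℝ (p.constraint j) x d ≤ 0) :
    0 ≤ fderiv ℝ p.objective x d := by
  have hfeas : ∀ᶠ t : ℝ in 𝓝[>] 0, x + t • d ∈ p.feasibleSet := by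
    refine eventually_all.2 fun j => ?_
    rcases (hx j).eq_or_lt with hactive | hinactive
    · exact hq j d hactive (hd j hactive)
    · have hcont : Continuous fun t : ℝ => p.constraint j (x + t • d) :=
        (p.contDiff_constraint j).continuous.comp (by fun_prop)
      exact nhdsWithin_le_nhds ((hcont.tendsto' 0 (p.constraint j x) (by simp)).eventually
        (ge_mem_nhds hinactive))
  exact hmin.localize.hasFDerivWithinAt_nonneg
    (p.contDiff_objective.differentiable one_ne_zero x).hasFDerivAt.hasFDerivWithinAt
    (mem_posTangentConeAt_of_frequently_mem hfeas.frequently)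

variable [Fintype J]

/-- The Lagrangian of a convex program. -/
def lagrangian (x : E) (y : J → ℝ) : ℝ := p.objective x + ∑ j, y j * p.constraint j x

/-- Saddle points of the Lagrangian over all primal points and all nonnegative multipliers. -/
def IsSaddlePoint (x : E) (y : J → ℝ) : Prop :=
  0 ≤ y ∧ (∀ x', p.lagrangian x y ≤ p.lagrangian x' y) ∧
    ∀ y', 0 ≤ y' → p.lagrangian x y' ≤ p.lagrangian x y

theorem contDiff_lagrangian (y : J → ℝ) : ContDiff ℝ 1 fun x => p.lagrangian x y :=
  p.contDiff_objective.add
    (ContDiff.sum fun j _ => contDiff_const.mul (p.contDiff_constraint j))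

theorem continuous_lagrangian {X : Type*} [TopologicalSpace X] {x : X → E} {y : X → J → ℝ}
    (hx : Continuous x) (hy : Continuous y) : Continuous fun a => p.lagrangian (x a) (y a) :=
  (p.contDiff_objective.continuous.comp hx).add <| continuous_finsetSum _ fun j _ =>
    ((continuous_apply j).comp hy).mul ((p.contDiff_constraint j).continuous.comp hx)

theorem fderiv_lagrangian (x : E) (y : J → ℝ) :
    fderiv ℝ (fun x => p.lagrangian x y) x =
      fderiv ℝ p.objective x + ∑ j, y j • fderiv ℝ (p.constraint j) x :=
  ((p.contDiff_objective.differentiable one_ne_zero x).hasFDerivAt.add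
    (HasFDerivAt.fun_sum fun j _ => ((p.contDiff_constraint j).differentiable one_ne_zero
      x).hasFDerivAt.const_mul (y j))).fderiv

theorem convexOn_sum_constraint {y : J → ℝ} (hy : 0 ≤ y) :
    ConvexOn ℝ univ fun x => ∑ j, y j * p.constraint j x :=
  ⟨convex_univ, fun x _ x' _ a b ha hb hab => by
    simp only [Finset.smul_sum, ← Finset.sum_add_distrib]
    exact Finset.sum_le_sum fun j _ =>
      ((p.convexOn_constraint j).smul (hy j)).2 (mem_univ x) (mem_univ x') ha hb hab⟩

theorem convexOn_lagrangian {y : J → ℝ} (hy : 0 ≤ y) :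
    ConvexOn ℝ univ fun x => p.lagrangian x y :=
  p.convexOn_objective.add (p.convexOn_sum_constraint hy)

theorem lagrangian_add_fderiv_le {y : J → ℝ} (hy : 0 ≤ y) (x x' : E) :
    p.lagrangian x y + fderiv ℝ (fun x => p.lagrangian x y) x (x' - x) ≤ p.lagrangian x' y :=
  add_fderiv_sub_le_of_convexOn (p.convexOn_lagrangian hy)
    ((p.contDiff_lagrangian y).differentiable one_ne_zero x) x'

variable {p}

theorem exists_isSaddlePoint_of_isMinOn {x : E} (hx : x ∈ p.feasibleSet)
    (hmin : IsMinOn p.objective p.feasibleSet x) (hq : p.IsQualified x) :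
    ∃ y, p.IsSaddlePoint x y := by
  classical
  obtain ⟨y, hy, hinactive, hsum⟩ := exists_nonneg_sum_smul_eq_of_forall_nonpos
    (Finset.univ.filter fun j => p.constraint j x = 0)
    (fun j => (fderiv ℝ (p.constraint j) x : E →ₗ[ℝ] ℝ)) (-(fderiv ℝ p.objective x : E →ₗ[ℝ] ℝ))
    fun d hd => neg_nonpos.2 <| fderiv_objective_nonneg hx hmin hq fun j hj =>
      hd j (by simpa using hj)
  have hstationary : ∀ d, fderiv ℝ (fun x => p.lagrangian x y) x d = 0 := fun d => by
    rw [fderiv_lagrangian, add_comm]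
    simpa [add_eq_zero_iff_eq_neg] using LinearMap.congr_fun hsum d
  have hcompl : ∀ j, y j * p.constraint j x = 0 := fun j => by
    by_cases hj : p.constraint j x = 0
    · rw [hj, mul_zero]
    · rw [hinactive j (by simpa using hj), zero_mul]
  refine ⟨y, hy, fun x' => ?_, fun y' hy' => ?_⟩
  · simpa [hstationary] using p.lagrangian_add_fderiv_le hy x x'
  · exact add_le_add_right (Finset.sum_le_sum fun j _ =>
      (mul_nonpos_of_nonneg_of_nonpos (hy' j) (hx j)).trans_eq (hcompl j).symm) _

theorem IsSaddlePoint.fst_eq_of_lagrangian_le {x x' : E} {y : J → ℝ}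
    (h : p.IsSaddlePoint x y) (hf : StrictConvexOn ℝ univ p.objective)
    (hx' : p.lagrangian x' y ≤ p.lagrangian x y) : x' = x :=
  (hf.add_convexOn (p.convexOn_sum_constraint h.1)).eq_of_isMinOn
    (fun x'' _ => hx'.trans (h.2.1 x'')) (fun x'' _ => h.2.1 x'') (mem_univ x') (mem_univ x)

end Multipliers

end ConvexProgram

section AbsolutelyContinuous

theorem absolutelyContinuousOnInterval_comp_of_locallyLipschitz {X Y : Type*}
    [SeminormedAddCommGroup X] [PseudoMetricSpace Y] {φ : X → Y} {f : ℝ → X} {a b : ℝ}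
    (hφ : LocallyLipschitz φ) (hf : AbsolutelyContinuousOnInterval f a b) :
    AbsolutelyContinuousOnInterval (φ ∘ f) a b := by
  obtain ⟨K, hK⟩ := (hφ.locallyLipschitzOn (s := f '' uIcc a b)).exists_lipschitzOnWith_of_compact
    (isCompact_uIcc.image_of_continuousOn hf.continuousOn)
  refine squeeze_zero' (Eventually.of_forall fun _ => Finset.sum_nonneg fun _ _ => dist_nonneg) ?_
    (by simpa using Tendsto.const_mul (K : ℝ) hf)
  filter_upwards [mem_inf_of_right (mem_principal_self _)] with I hI
  rw [Finset.mul_sum]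
  exact Finset.sum_le_sum fun i hi => hK.dist_le_mul
    _ (mem_image_of_mem f (hI.1 i hi).1) _ (mem_image_of_mem f (hI.1 i hi).2)

theorem sub_le_mul_of_ae_deriv_le {u : ℝ → ℝ} {a b C : ℝ} (hab : a ≤ b)
    (hu : AbsolutelyContinuousOnInterval u a b)
    (hC : ∀ᵐ t ∂volume, t ∈ Ioo a b → deriv u t ≤ C) : u b - u a ≤ C * (b - a) := by
  have hint : ∫ t in a..b, deriv u t ≤ ∫ _ in a..b, C := by
    refine intervalIntegral.integral_mono_ae_restrict hab hu.intervalIntegrable_deriv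
      intervalIntegrable_const ?_
    rw [← restrict_Ioo_eq_restrict_Icc]
    exact (ae_restrict_iff' measurableSet_Ioo).2 hC
  rwa [hu.integral_deriv_eq_sub, intervalIntegral.integral_const, smul_eq_mul, mul_comm] at hint

end AbsolutelyContinuous

theorem exists_tendsto_atTop_of_antitoneOn {f : ℝ → ℝ} {a b : ℝ} (hf : AntitoneOn f (Ici a))
    (hb : ∀ t, a ≤ t → b ≤ f t) : ∃ l, Tendsto f atTop (𝓝 l) := by
  have hanti : Antitone fun t => f (max t a) := fun s t hst =>
    hf (le_max_right s a) (le_max_right t a) (max_le_max_right a hst)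
  refine ⟨_, (tendsto_atTop_ciInf hanti ⟨b, ?_⟩).congr' ?_⟩
  · rintro _ ⟨t, rfl⟩
    exact hb _ (le_max_right t a)
  · filter_upwards [eventually_ge_atTop a] with t ht
    rw [max_eq_left ht]

theorem tendsto_of_antitoneOn_dist_of_mapClusterPt {X : Type*} [PseudoMetricSpace X] {z : ℝ → X}
    {w : X} {a : ℝ} (hanti : AntitoneOn (fun t => dist (z t) w) (Ici a))
    (hw : MapClusterPt w atTop z) : Tendsto z atTop (𝓝 w) := by
  refine Metric.tendsto_atTop.2 fun ε hε => ?_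
  have hnear := mapClusterPt_iff_frequently.1 hw _ (Metric.ball_mem_nhds w hε)
  obtain ⟨T, hTw, hT⟩ := (hnear.and_eventually (eventually_ge_atTop a)).exists
  exact ⟨T, fun t ht => (hanti hT (hT.trans ht) ht).trans_lt hTw⟩

/-- Carathéodory solutions on `[0, ∞)`, with values in `S`, of the differential equation
`z' = V z`, whose right-hand side may be discontinuous. -/
structure IsCaratheodorySolution {H : Type*} [NormedAddCommGroup H] [NormedSpace ℝ H]
    (V : H → H) (S : Set H) (z : ℝ → H) : Prop where
  absCont : ∀ T, 0 ≤ T → AbsolutelyContinuousOnInterval z 0 T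
  mem : ∀ t, 0 ≤ t → z t ∈ S
  hasDeriv : ∀ᵐ t ∂volume, 0 < t → HasDerivAt z (V (z t)) t

namespace IsCaratheodorySolution

variable {H : Type*} [NormedAddCommGroup H] [NormedSpace ℝ H] {V : H → H} {S : Set H}
  {z : ℝ → H} {φ : H → ℝ}

theorem map {H' : Type*} [NormedAddCommGroup H'] [NormedSpace ℝ H'] {V' : H' → H'} {S' : Set H'}
    (hz : IsCaratheodorySolution V S z) (Φ : H →L[ℝ] H') (hS : MapsTo Φ S S')
    (hV : ∀ x ∈ S, Φ (V x) = V' (Φ x)) : IsCaratheodorySolution V' S' (Φ ∘ z) where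
  absCont T hT := absolutelyContinuousOnInterval_comp_of_locallyLipschitz
    Φ.lipschitz.locallyLipschitz (hz.absCont T hT)
  mem t ht := hS (hz.mem t ht)
  hasDeriv := hz.hasDeriv.mono fun t ht ht0 =>
    (Φ.hasFDerivAt.comp_hasDerivAt t (ht ht0)).congr_deriv (hV _ (hz.mem t ht0.le))

theorem comp_sub_comp_le (hz : IsCaratheodorySolution V S z) (hφ : ContDiff ℝ 1 φ) {a b C : ℝ}
    (ha : 0 ≤ a) (hab : a ≤ b) (hC : ∀ t ∈ Ioo a b, fderiv ℝ φ (z t) (V (z t)) ≤ C) :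
    φ (z b) - φ (z a) ≤ C * (b - a) := by
  have hac : AbsolutelyContinuousOnInterval (φ ∘ z) a b :=
    (absolutelyContinuousOnInterval_comp_of_locallyLipschitz hφ.locallyLipschitz
      (hz.absCont b (ha.trans hab))).mono (by
        rw [uIcc_of_le hab, uIcc_of_le (ha.trans hab)]
        exact Icc_subset_Icc_left ha)
  refine sub_le_mul_of_ae_deriv_le hab hac (hz.hasDeriv.mono fun t ht htI => ?_)
  have hder := (hφ.differentiable one_ne_zero (z t)).hasFDerivAt.comp_hasDerivAt t
    (ht (ha.trans_lt htI.1))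
  exact hder.deriv.trans_le (hC t htI)

theorem antitoneOn_comp (hz : IsCaratheodorySolution V S z) (hφ : ContDiff ℝ 1 φ)
    (hV : ∀ x ∈ S, fderiv ℝ φ x (V x) ≤ 0) : AntitoneOn (φ ∘ z) (Ici 0) := by
  intro a ha b _ hab
  have := hz.comp_sub_comp_le hφ ha hab fun t ht => hV _ (hz.mem t (ha.trans ht.1.le))
  rwa [zero_mul, sub_nonpos] at this

theorem dist_le (hz : IsCaratheodorySolution V S z) {a b B : ℝ} (ha : 0 ≤ a) (hab : a ≤ b)
    (hB : ∀ t, 0 ≤ t → ‖V (z t)‖ ≤ B) : dist (z a) (z b) ≤ B * (b - a) := by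
  obtain ⟨ℓ, hℓ, hℓz⟩ := exists_dual_vector'' ℝ (z b - z a)
  have hinc := hz.comp_sub_comp_le (C := B) ℓ.contDiff ha hab fun t ht => by
    rw [ℓ.fderiv]
    calc ℓ (V (z t)) ≤ ‖ℓ‖ * ‖V (z t)‖ := (le_abs_self _).trans (ℓ.le_opNorm _)
      _ ≤ 1 * B := mul_le_mul hℓ (hB t (ha.trans ht.1.le)) (norm_nonneg _) zero_le_one
      _ = B := one_mul B
  rwa [← map_sub, hℓz, RCLike.ofReal_real_eq_id, id, ← dist_eq_norm, dist_comm] at hinc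

theorem uniformContinuousOn (hz : IsCaratheodorySolution V S z) {B : ℝ}
    (hB : ∀ t, 0 ≤ t → ‖V (z t)‖ ≤ B) : UniformContinuousOn z (Ici 0) := by
  refine (LipschitzOnWith.of_dist_le_mul (K := B.toNNReal) fun a ha b hb => ?_).uniformContinuousOn
  rw [Real.coe_toNNReal B ((norm_nonneg _).trans (hB 0 le_rfl)), Real.dist_eq]
  rcases le_total a b with hab | hab
  · rw [abs_sub_comm, abs_of_nonneg (sub_nonneg.2 hab)]
    exact hz.dist_le ha hab hB
  · rw [abs_of_nonneg (sub_nonneg.2 hab), dist_comm]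
    exact hz.dist_le hb hab hB

/- Barbalat's argument: otherwise `φ ∘ z` would drop by a fixed amount on intervals of a fixed
length, arbitrarily late. -/
theorem nonpos_of_mapClusterPt (hz : IsCaratheodorySolution V S z)
    (huc : UniformContinuousOn z (Ici 0)) (hφ : ContDiff ℝ 1 φ) {ψ : H → ℝ} (hψ : Continuous ψ)
    (hV : ∀ x ∈ S, fderiv ℝ φ x (V x) ≤ -ψ x) {l : ℝ} (hl : Tendsto (φ ∘ z) atTop (𝓝 l))
    {w : H} (hw : MapClusterPt w atTop z) : ψ w ≤ 0 := by
  by_contra! hpos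
  obtain ⟨r, hr, hball⟩ := Metric.eventually_nhds_iff_ball.1
    (hψ.continuousAt.eventually (lt_mem_nhds (half_lt_self hpos)))
  obtain ⟨δ, hδ, hzδ⟩ := Metric.uniformContinuousOn_iff.1 huc (r / 2) (half_pos hr)
  have hdiff : Tendsto (fun t => φ (z (t + δ)) - φ (z t)) atTop (𝓝 0) := by
    simpa using (hl.comp (tendsto_atTop_add_const_right atTop δ tendsto_id)).sub hl
  have hnear := mapClusterPt_iff_frequently.1 hw _ (Metric.ball_mem_nhds w (half_pos hr))
  obtain ⟨t, htw, ht0, hsmall⟩ := (hnear.and_eventually ((eventually_ge_atTop 0).and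
    (hdiff.eventually (lt_mem_nhds (neg_lt_zero.2 (mul_pos (half_pos hpos) hδ)))))).exists
  have hdrop := hz.comp_sub_comp_le (C := -(ψ w / 2)) hφ ht0 (le_add_of_nonneg_right hδ.le)
    fun s hs => by
      have hs0 : 0 ≤ s := ht0.trans hs.1.le
      have hst : dist (z s) (z t) < r / 2 := hzδ s hs0 t ht0 (by
        rw [Real.dist_eq, abs_of_pos (sub_pos.2 hs.1)]
        linarith [hs.2])
      have hsw : dist (z s) w < r := by
        linarith [dist_triangle (z s) (z t) w, Metric.mem_ball.1 htw]
      linarith [hV (z s) (hz.mem s hs0), hball (z s) hsw]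
  rw [add_sub_cancel_left] at hdrop
  linarith

end IsCaratheodorySolution

theorem abs_switchPlus_le (x y : ℝ) : |switchPlus x y| ≤ |x| := by
  unfold switchPlus
  split_ifs
  · exact le_rfl
  · rw [abs_of_nonneg (le_max_right x 0)]
    exact max_le (le_abs_self x) (abs_nonneg x)

theorem sub_mul_switchPlus_le {x y y' : ℝ} (hy : 0 ≤ y) (hy' : 0 ≤ y') :
    (y - y') * switchPlus x y ≤ (y - y') * x := by
  unfold switchPlus
  split_ifs with hpos
  · exact le_rfl
  · exact mul_le_mul_of_nonpos_left (le_max_left x 0)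
      (by rwa [(not_lt.1 hpos).antisymm hy, zero_sub, neg_nonpos])

namespace ConvexProgram

/-- The space of pairs of a primal point and a vector of multipliers, with the Euclidean structure
for which the saddle-point dynamics does not move away from any saddle point. -/
abbrev PrimalDual (E J : Type*) : Type _ := WithLp 2 (E × EuclideanSpace ℝ J)

section SaddleField

variable {E J : Type*} [NormedAddCommGroup E] [InnerProductSpace ℝ E] [CompleteSpace E]
  [Fintype J]

/-- The right-hand side of the saddle-point dynamics: gradient descent of the Lagrangian in the
primal variable and projected gradient ascent in the multipliers. -/
noncomputable def saddleField (p : ConvexProgram E J) (z : PrimalDual E J) : PrimalDual E J :=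
  WithLp.toLp 2 (-gradient (fun x => p.lagrangian x z.snd.ofLp) z.fst,
    WithLp.toLp 2 fun j => switchPlus (p.constraint j z.fst) (z.snd j))

variable {p : ConvexProgram E J} {z : ℝ → PrimalDual E J} {w w' : PrimalDual E J}

theorem continuous_gradient_lagrangian :
    Continuous fun z : PrimalDual E J =>
      gradient (fun x => p.lagrangian x z.snd.ofLp) z.fst := by
  refine (InnerProductSpace.toDual ℝ E).symm.continuous.comp ?_
  simp only [fderiv_lagrangian]
  have hfst : Continuous fun z : PrimalDual E J => z.fst := by fun_prop
  have hsnd : ∀ j, Continuous fun z : PrimalDual E J => z.snd j := fun j => by fun_prop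
  exact ((p.contDiff_objective.continuous_fderiv one_ne_zero).comp hfst).add <|
    continuous_finsetSum _ fun j _ => (hsnd j).smul
      (((p.contDiff_constraint j).continuous_fderiv one_ne_zero).comp hfst)

theorem inner_sub_saddleField_le (hw : 0 ≤ w.snd.ofLp) (hw' : 0 ≤ w'.snd.ofLp) :
    inner ℝ (w' - w) (p.saddleField w') ≤
      p.lagrangian w.fst w'.snd.ofLp - p.lagrangian w'.fst w.snd.ofLp := by
  have hprimal : inner ℝ (w'.fst - w.fst) (p.saddleField w').fst ≤
      p.lagrangian w.fst w'.snd.ofLp - p.lagrangian w'.fst w'.snd.ofLp := by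
    have h := p.lagrangian_add_fderiv_le hw' w'.fst w.fst
    change inner ℝ (w'.fst - w.fst) (-gradient _ w'.fst) ≤ _
    rw [inner_neg_right, ← inner_neg_left, neg_sub, real_inner_comm, inner_gradient_left]
    linarith
  have hdual : inner ℝ (w'.snd - w.snd) (p.saddleField w').snd ≤
      p.lagrangian w'.fst w'.snd.ofLp - p.lagrangian w'.fst w.snd.ofLp := by
    simp only [lagrangian, add_sub_add_left_eq_sub, ← Finset.sum_sub_distrib, ← sub_mul]
    rw [real_inner_comm, PiLp.inner_apply]
    exact Finset.sum_le_sum fun j _ => sub_mul_switchPlus_le (hw' j) (hw j)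
  rw [WithLp.prod_inner_apply]
  exact (add_le_add hprimal hdual).trans_eq (sub_add_sub_cancel _ _ _)

theorem fderiv_norm_sub_sq_saddleField_le (hw : 0 ≤ w.snd.ofLp) (hw' : 0 ≤ w'.snd.ofLp) :
    fderiv ℝ (fun v => ‖v - w‖ ^ 2) w' (p.saddleField w') ≤
      -(2 * (p.lagrangian w'.fst w.snd.ofLp - p.lagrangian w.fst w'.snd.ofLp)) := by
  have hder : HasFDerivAt (fun v => ‖v - w‖ ^ 2) (2 • innerSL ℝ (w' - w)) w' := by
    simpa using ((hasFDerivAt_id w').sub_const w).norm_sq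
  rw [hder.fderiv]
  have h := inner_sub_saddleField_le (p := p) hw hw'
  simp only [_root_.smul_apply, innerSL_apply_apply, nsmul_eq_mul, Nat.cast_ofNat]
  linarith

theorem exists_forall_norm_saddleField_le (p : ConvexProgram E J) {K : Set (PrimalDual E J)}
    (hK : IsCompact K) : ∃ B, ∀ w ∈ K, ‖p.saddleField w‖ ≤ B := by
  have hfst : Continuous fun w : PrimalDual E J => w.fst := by fun_prop
  have hcont : Continuous fun w : PrimalDual E J =>
      ‖gradient (fun x => p.lagrangian x w.snd.ofLp) w.fst‖ ^ 2 + ∑ j, p.constraint j w.fst ^ 2 :=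
    (continuous_gradient_lagrangian.norm.pow 2).add <| continuous_finsetSum _ fun j _ =>
      ((p.contDiff_constraint j).continuous.comp hfst).pow 2
  obtain ⟨C, hC⟩ := (hK.image hcont).bddAbove
  refine ⟨√C, fun w hw => Real.le_sqrt_of_sq_le (le_trans ?_ (hC (mem_image_of_mem _ hw)))⟩
  rw [WithLp.prod_norm_sq_eq_of_L2, EuclideanSpace.real_norm_sq_eq]
  exact add_le_add (congrArg (· ^ 2) (norm_neg (gradient _ _))).le
    (Finset.sum_le_sum fun j _ => sq_le_sq.2 (abs_switchPlus_le _ _))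

theorem nonneg_snd_of_mapClusterPt
    (hz : IsCaratheodorySolution p.saddleField {w | 0 ≤ w.snd.ofLp} z)
    (hw' : MapClusterPt w' atTop z) : 0 ≤ w'.snd.ofLp :=
  have hclosed : IsClosed {w : PrimalDual E J | 0 ≤ w.snd.ofLp} :=
    isClosed_le continuous_const (by fun_prop)
  hclosed.mem_of_mapClusterPt hw' ((eventually_ge_atTop 0).mono hz.mem)

theorem IsSaddlePoint.antitoneOn_dist (hw : p.IsSaddlePoint w.fst w.snd.ofLp)
    (hz : IsCaratheodorySolution p.saddleField {w | 0 ≤ w.snd.ofLp} z) :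
    AntitoneOn (fun t => dist (z t) w) (Ici 0) := by
  have hanti : AntitoneOn ((fun v => ‖v - w‖ ^ 2) ∘ z) (Ici 0) :=
    hz.antitoneOn_comp ((contDiff_id.sub contDiff_const).norm_sq ℝ) fun w' hw' =>
      (fderiv_norm_sub_sq_saddleField_le hw.1 hw').trans (by
        linarith [hw.2.1 w'.fst, hw.2.2 w'.snd.ofLp hw'])
  intro s hs t ht hst
  simpa only [dist_eq_norm] using
    (sq_le_sq₀ (norm_nonneg _) (norm_nonneg _)).1 (hanti hs ht hst)

end SaddleField

namespace IsSaddlePoint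

variable {E J : Type*} [NormedAddCommGroup E] [InnerProductSpace ℝ E] [FiniteDimensional ℝ E]
  [Fintype J] {p : ConvexProgram E J} {z : ℝ → PrimalDual E J} {w w' : PrimalDual E J}

theorem uniformContinuousOn (hw : p.IsSaddlePoint w.fst w.snd.ofLp)
    (hz : IsCaratheodorySolution p.saddleField {w | 0 ≤ w.snd.ofLp} z) :
    UniformContinuousOn z (Ici 0) := by
  obtain ⟨B, hB⟩ := p.exists_forall_norm_saddleField_le
    (isCompact_closedBall w (dist (z 0) w))
  exact hz.uniformContinuousOn fun t ht =>
    hB _ (hw.antitoneOn_dist hz self_mem_Ici ht ht)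

theorem exists_mapClusterPt (hw : p.IsSaddlePoint w.fst w.snd.ofLp)
    (hz : IsCaratheodorySolution p.saddleField {w | 0 ≤ w.snd.ofLp} z) :
    ∃ w', MapClusterPt w' atTop z := by
  obtain ⟨w', -, hw'⟩ := (isCompact_closedBall w (dist (z 0) w)).exists_mapClusterPt_of_frequently
    ((eventually_ge_atTop (0 : ℝ)).mono fun t ht =>
      hw.antitoneOn_dist hz self_mem_Ici ht ht).frequently
  exact ⟨w', hw'⟩

theorem lagrangian_le_of_mapClusterPt (hw : p.IsSaddlePoint w.fst w.snd.ofLp)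
    (hz : IsCaratheodorySolution p.saddleField {w | 0 ≤ w.snd.ofLp} z)
    (hw' : MapClusterPt w' atTop z) :
    p.lagrangian w'.fst w.snd.ofLp ≤ p.lagrangian w.fst w'.snd.ofLp := by
  obtain ⟨l, hl⟩ := exists_tendsto_atTop_of_antitoneOn (hw.antitoneOn_dist hz)
    fun t _ => dist_nonneg
  have hψ : Continuous fun v : PrimalDual E J =>
      2 * (p.lagrangian v.fst w.snd.ofLp - p.lagrangian w.fst v.snd.ofLp) :=
    continuous_const.mul ((p.continuous_lagrangian (by fun_prop) continuous_const).sub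
      (p.continuous_lagrangian continuous_const (by fun_prop)))
  have h := hz.nonpos_of_mapClusterPt (hw.uniformContinuousOn hz)
    ((contDiff_id.sub contDiff_const).norm_sq ℝ) hψ
    (fun v hv => fderiv_norm_sub_sq_saddleField_le hw.1 hv)
    (by simpa only [dist_eq_norm, Function.comp_def, id] using hl.pow 2) hw'
  linarith

theorem fst_eq_of_mapClusterPt (hw : p.IsSaddlePoint w.fst w.snd.ofLp)
    (hf : StrictConvexOn ℝ univ p.objective)
    (hz : IsCaratheodorySolution p.saddleField {w | 0 ≤ w.snd.ofLp} z)
    (hw' : MapClusterPt w' atTop z) : w'.fst = w.fst :=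
  hw.fst_eq_of_lagrangian_le hf ((hw.lagrangian_le_of_mapClusterPt hz hw').trans
    (hw.2.2 _ (nonneg_snd_of_mapClusterPt hz hw')))

theorem tendsto_fst (hw : p.IsSaddlePoint w.fst w.snd.ofLp)
    (hf : StrictConvexOn ℝ univ p.objective)
    (hz : IsCaratheodorySolution p.saddleField {w | 0 ≤ w.snd.ofLp} z) :
    Tendsto (fun t => (z t).fst) atTop (𝓝 w.fst) := by
  have hset : Tendsto z atTop (𝓝ˢ (WithLp.fst ⁻¹' {w.fst})) :=
    (isCompact_closedBall w (dist (z 0) w)).tendsto_nhdsSet_of_mapClusterPt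
      ((eventually_ge_atTop 0).mono fun t ht => hw.antitoneOn_dist hz self_mem_Ici ht ht)
      fun w' _ hw' => hw.fst_eq_of_mapClusterPt hf hz hw'
  have hfst := (WithLp.continuous_fst 2 E (EuclideanSpace ℝ J)).tendsto_nhdsSet
    (mapsTo_preimage WithLp.fst {w.fst})
  exact nhdsSet_singleton (x := w.fst) ▸ hfst.comp hset

/- Once the primal part has converged, its velocity must vanish at the cluster points: otherwise
it would drift in the direction of the limiting gradient. -/
theorem gradient_eq_zero_of_mapClusterPt (hw : p.IsSaddlePoint w.fst w.snd.ofLp)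
    (hf : StrictConvexOn ℝ univ p.objective)
    (hz : IsCaratheodorySolution p.saddleField {w | 0 ≤ w.snd.ofLp} z)
    (hw' : MapClusterPt w' atTop z) :
    gradient (fun x => p.lagrangian x w'.snd.ofLp) w'.fst = 0 := by
  set v := gradient (fun x => p.lagrangian x w'.snd.ofLp) w'.fst
  let φ : PrimalDual E J →L[ℝ] ℝ := innerSL ℝ v ∘L WithLp.fstL 2 ℝ E (EuclideanSpace ℝ J)
  have hφ : Tendsto (φ ∘ z) atTop (𝓝 (inner ℝ v w.fst)) :=
    ((innerSL ℝ v).continuous.tendsto w.fst).comp (hw.tendsto_fst hf hz)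
  have h := hz.nonpos_of_mapClusterPt (hw.uniformContinuousOn hz) φ.contDiff
    ((innerSL ℝ v).continuous.comp continuous_gradient_lagrangian)
    (fun u _ => by rw [φ.fderiv]; exact (inner_neg_right v _).le) hφ hw'
  exact real_inner_self_nonpos.1 h

theorem of_mapClusterPt (hw : p.IsSaddlePoint w.fst w.snd.ofLp)
    (hf : StrictConvexOn ℝ univ p.objective)
    (hz : IsCaratheodorySolution p.saddleField {w | 0 ≤ w.snd.ofLp} z)
    (hw' : MapClusterPt w' atTop z) : p.IsSaddlePoint w'.fst w'.snd.ofLp := by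
  have hnonneg := nonneg_snd_of_mapClusterPt hz hw'
  have hle := hw.lagrangian_le_of_mapClusterPt hz hw'
  refine ⟨hnonneg, fun x => ?_, fun y hy => ?_⟩
  · simpa [← inner_gradient_left, hw.gradient_eq_zero_of_mapClusterPt hf hz hw'] using
      p.lagrangian_add_fderiv_le hnonneg w'.fst x
  · rw [hw.fst_eq_of_mapClusterPt hf hz hw'] at hle ⊢
    exact (hw.2.2 y hy).trans hle

theorem exists_tendsto (hw : p.IsSaddlePoint w.fst w.snd.ofLp)
    (hf : StrictConvexOn ℝ univ p.objective)
    (hz : IsCaratheodorySolution p.saddleField {w | 0 ≤ w.snd.ofLp} z) :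
    ∃ w', p.IsSaddlePoint w'.fst w'.snd.ofLp ∧ w'.fst = w.fst ∧ Tendsto z atTop (𝓝 w') := by
  obtain ⟨w', hw'⟩ := hw.exists_mapClusterPt hz
  have hsaddle := hw.of_mapClusterPt hf hz hw'
  exact ⟨w', hsaddle, hw.fst_eq_of_mapClusterPt hf hz hw',
    tendsto_of_antitoneOn_dist_of_mapClusterPt (hsaddle.antitoneOn_dist hz) hw'⟩

end IsSaddlePoint

end ConvexProgram

namespace PowerNetwork

variable {nb n : ℕ}

/-- The Euclidean space of decision variables; `Power nb` itself carries the sup norm of its two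
components. -/
abbrev PowerSpace (nb : ℕ) : Type := PiLp 2 fun _ : Fin 2 => EuclideanSpace ℝ (Fin nb)

/- Without this shortcut instance search gets lost in the nested `PiLp` structure. -/
instance : ContinuousSMul ℝ (PowerSpace nb) := IsBoundedSMul.continuousSMul

/-- The index type of the constraints: the line thresholds, the upper bounds and the lower
bounds. -/
abbrev Constraint (N : PowerNetwork nb n) : Type := N.Edge ⊕ (Fin 2 × Fin nb) ⊕ (Fin 2 × Fin nb)

/-- The linear part of the linearized transmission power `Phat`. -/
noncomputable def PhatLinear (N : PowerNetwork nb n) (m : ℕ) (i j : Fin nb) :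
    PowerSpace nb →L[ℝ] ℝ :=
  ∑ k, innerSL ℝ (WithLp.toLp 2 (N.R m k i j)) ∘L PiLp.proj 2 _ k

/-- The injected power of one bus at one of the two steps. -/
noncomputable def coordinate (q : Fin 2 × Fin nb) : PowerSpace nb →L[ℝ] ℝ :=
  PiLp.proj 2 _ q.2 ∘L PiLp.proj 2 _ q.1

/-- The entrywise weights `W`, acting on both decision variables. -/
noncomputable def weightMap (N : PowerNetwork nb n) : PowerSpace nb →ₗ[ℝ] PowerSpace nb where
  toFun x := WithLp.toLp 2 fun k => WithLp.toLp 2 fun i => N.W i * x k i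
  map_add' x y := by ext; simp [mul_add]
  map_smul' a x := by ext; simp [mul_left_comm]

variable (N : PowerNetwork nb n) (m : ℕ)

theorem Phat_eq_PhatLinear_sub (i j : Fin nb) (x : PowerSpace nb) :
    N.Phat m i j x.ofLp = N.PhatLinear m i j x - N.R m 0 i j ⬝ᵥ N.P0.ofLp := by
  simp [Phat, PhatLinear, Fin.sum_univ_two, dotProduct_sub, EuclideanSpace.inner_eq_star_dotProduct,
    dotProduct_comm, sub_add_eq_add_sub]

theorem cost_eq_norm_weightMap_sq (x : PowerSpace nb) :
    N.cost x.ofLp = ‖N.weightMap (x - WithLp.toLp 2 fun _ => N.P0)‖ ^ 2 := by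
  rw [PiLp.norm_sq_eq_of_L2]
  rfl

theorem weightMap_injective {N : PowerNetwork nb n} (hW : ∀ i, N.W i ≠ 0) :
    Function.Injective N.weightMap := fun x y hxy => by
  ext k i
  exact mul_left_cancel₀ (hW i) (congrArg (fun v : PowerSpace nb => v k i) hxy)

/-- The linearized two-step problem as a convex program. -/
noncomputable def program : ConvexProgram (PowerSpace nb) N.Constraint where
  objective x := N.cost x.ofLp
  constraint := Sum.elim (fun e x => N.Phat m e.1.1 e.1.2 x.ofLp ^ 2 - N.thr e.1.1 e.1.2 ^ 2)
    (Sum.elim (fun q x => x q.1 q.2 - N.Phi q.2) fun q x => N.Plo q.2 - x q.1 q.2)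
  contDiff_objective := by
    simp only [cost_eq_norm_weightMap_sq]
    exact (N.weightMap.toContinuousLinearMap.contDiff.comp
      (contDiff_id.sub contDiff_const)).norm_sq ℝ
  contDiff_constraint := by
    rintro (e | q | q) <;>
      simp only [Sum.elim_inl, Sum.elim_inr, Phat_eq_PhatLinear_sub] <;> fun_prop
  convexOn_objective := by
    simp only [cost_eq_norm_weightMap_sq]
    exact convexOn_norm_map_sub_sq _ _
  convexOn_constraint := by
    rintro (e | q | q) <;>
      simp only [Sum.elim_inl, Sum.elim_inr, Phat_eq_PhatLinear_sub, sub_eq_add_neg]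
    · exact (convexOn_add_const_sq (N.PhatLinear m _ _).toLinearMap _).add_const _
    · exact ((coordinate q).toLinearMap.convexOn convex_univ).add_const _
    · exact (convexOn_const _ convex_univ).add
        ((coordinate q).toLinearMap.concaveOn convex_univ).neg

theorem strictConvexOn_program_objective {N : PowerNetwork nb n} (hW : ∀ i, N.W i ≠ 0) :
    StrictConvexOn ℝ univ (N.program m).objective := by
  simp only [program, cost_eq_norm_weightMap_sq]
  exact strictConvexOn_norm_map_sub_sq (weightMap_injective hW) _

theorem mem_feasible_iff (P : Power nb) :
    P ∈ N.feasible m ↔ WithLp.toLp 2 P ∈ (N.program m).feasibleSet := by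
  simp only [feasible, ConvexProgram.feasibleSet, program, mem_ofPred_eq, Sum.forall, Sum.elim_inl,
    Sum.elim_inr, sub_nonpos, Prod.forall, forall_and, and_comm]

/-- The multipliers of the network as a single family indexed by all constraints. -/
noncomputable def multiplierEquiv : N.Multiplier ≃L[ℝ] (N.Constraint → ℝ) :=
  LinearEquiv.toContinuousLinearEquiv
    { toFun := fun μ => Sum.elim μ.1 (Sum.elim (fun q => μ.2.1 q.1 q.2) fun q => μ.2.2 q.1 q.2)
      invFun := fun y => (fun e => y (.inl e), fun k i => y (.inr (.inl (k, i))),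
        fun k i => y (.inr (.inr (k, i))))
      map_add' := fun μ ν => by ext (e | q | q) <;> rfl
      map_smul' := fun a μ => by ext (e | q | q) <;> rfl
      left_inv := fun μ => rfl
      right_inv := fun y => by ext (e | q | q) <;> rfl }

/-- The states of the saddle-point dynamics as primal-dual pairs of the convex program. -/
noncomputable def stateEquiv :
    N.State ≃L[ℝ] ConvexProgram.PrimalDual (PowerSpace nb) N.Constraint :=
  ((PiLp.continuousLinearEquiv 2 ℝ fun _ => EuclideanSpace ℝ (Fin nb)).symm.prodCongr
    (N.multiplierEquiv.trans (EuclideanSpace.equiv N.Constraint ℝ).symm)).trans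
      (WithLp.prodContinuousLinearEquiv 2 ℝ _ _).symm

theorem nonneg_multiplierEquiv_iff (μ : N.Multiplier) : 0 ≤ N.multiplierEquiv μ ↔ 0 ≤ μ := by
  constructor
  · intro h
    exact ⟨fun e => h (.inl e), fun k i => h (.inr (.inl (k, i))),
      fun k i => h (.inr (.inr (k, i)))⟩
  · rintro ⟨hl, hu, hd⟩ (e | q | q)
    exacts [hl e, hu q.1 q.2, hd q.1 q.2]

theorem program_lagrangian (P : Power nb) (μ : N.Multiplier) :
    (N.program m).lagrangian (WithLp.toLp 2 P) (N.multiplierEquiv μ) = N.lagrangian m P μ := by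
  have hedge : ∀ e, N.multiplierEquiv μ (.inl e) = μ.1 e := fun _ => rfl
  have hupper : ∀ q, N.multiplierEquiv μ (.inr (.inl q)) = μ.2.1 q.1 q.2 := fun _ => rfl
  have hlower : ∀ q, N.multiplierEquiv μ (.inr (.inr q)) = μ.2.2 q.1 q.2 := fun _ => rfl
  simp only [ConvexProgram.lagrangian, lagrangian, program, Fintype.sum_sum_type,
    Fintype.sum_prod_type, Sum.elim_inl, Sum.elim_inr, hedge, hupper, hlower]
  ring

theorem isSaddlePoint_stateEquiv_iff (P : Power nb) (μ : N.Multiplier) :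
    (N.program m).IsSaddlePoint (N.stateEquiv (P, μ)).fst (N.stateEquiv (P, μ)).snd.ofLp ↔
      N.IsSaddlePoint m P μ := by
  change (N.program m).IsSaddlePoint (WithLp.toLp 2 P) (N.multiplierEquiv μ) ↔ _
  simp only [ConvexProgram.IsSaddlePoint, IsSaddlePoint, nonneg_multiplierEquiv_iff,
    (WithLp.toLp_surjective 2).forall, N.multiplierEquiv.surjective.forall, program_lagrangian]

theorem stateEquiv_field (z : N.State) :
    N.stateEquiv (N.field m z) = (N.program m).saddleField (N.stateEquiv z) := by
  refine congrArg (WithLp.toLp 2) (Prod.ext ?_ ?_)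
  · ext1 k
    change -gradient (fun v => N.lagrangian m (Function.update z.1 k v) z.2) (z.1 k) =
      -gradient (fun x => (N.program m).lagrangian x (N.multiplierEquiv z.2)) (WithLp.toLp 2 z.1) k
    rw [← gradient_comp_update (((N.program m).contDiff_lagrangian _).differentiable one_ne_zero _)]
    simp only [program_lagrangian]
  · ext (e | q | q) <;> rfl

variable {N m}

theorem isCompact_feasibleSet_program (N : PowerNetwork nb n) (m : ℕ) :
    IsCompact (N.program m).feasibleSet := by
  have hbox : IsCompact ((PiLp.continuousLinearEquiv 2 ℝ fun _ : Fin 2 =>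
      EuclideanSpace ℝ (Fin nb)) ⁻¹' univ.pi fun _ => WithLp.ofLp ⁻¹' Icc N.Plo N.Phi) := by
    refine (PiLp.continuousLinearEquiv 2 ℝ fun _ : Fin 2 =>
      EuclideanSpace ℝ (Fin nb)).toHomeomorph.isCompact_preimage.2 <| isCompact_univ_pi fun _ => ?_
    exact (EuclideanSpace.equiv (Fin nb) ℝ).toHomeomorph.isCompact_preimage.2 isCompact_Icc
  refine hbox.of_isClosed_subset (N.program m).isClosed_feasibleSet fun x hx k _ => ?_
  exact ⟨fun i => sub_nonpos.1 (hx (.inr (.inr (k, i)))),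
    fun i => sub_nonpos.1 (hx (.inr (.inl (k, i))))⟩

theorem isQualified_program (hthr : ∀ e : N.Edge, 0 < N.thr e.1.1 e.1.2) (x : PowerSpace nb) :
    (N.program m).IsQualified x := by
  rintro (e | q | q) d <;>
    simp only [program, Sum.elim_inl, Sum.elim_inr, Phat_eq_PhatLinear_sub]
  · exact eventually_affine_sq_sub_sq_nonpos (ℓ := N.PhatLinear m e.1.1 e.1.2) (hthr e).ne'
  · exact eventually_affine_nonpos (ℓ := coordinate q) (c := -N.Phi q.2)
  · simp only [sub_eq_neg_add]
    exact eventually_affine_nonpos (ℓ := -coordinate q)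

theorem isOptimal_iff (P : Power nb) : N.IsOptimal m P ↔
    WithLp.toLp 2 P ∈ (N.program m).feasibleSet ∧
      IsMinOn (N.program m).objective (N.program m).feasibleSet (WithLp.toLp 2 P) := by
  simp only [IsOptimal, mem_feasible_iff, isMinOn_iff, (WithLp.toLp_surjective 2).forall]
  rfl

theorem exists_forall_isOptimal_iff_eq (hW : ∀ i, N.W i ≠ 0) (hfeas : (N.feasible m).Nonempty) :
    ∃ Pstar, ∀ P, N.IsOptimal m P ↔ P = Pstar := by
  obtain ⟨Q, hQ⟩ := hfeas
  obtain ⟨x, hx, hmin⟩ := (N.isCompact_feasibleSet_program m).exists_isMinOn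
    ⟨_, (N.mem_feasible_iff m Q).1 hQ⟩ (N.program m).contDiff_objective.continuous.continuousOn
  refine ⟨x.ofLp, fun P => ⟨fun hP => ?_, fun hP => hP ▸ (isOptimal_iff x.ofLp).2 ⟨hx, hmin⟩⟩⟩
  obtain ⟨hP, hPmin⟩ := (isOptimal_iff P).1 hP
  exact congrArg WithLp.ofLp <| ((strictConvexOn_program_objective m hW).subset (subset_univ _)
    (N.program m).convex_feasibleSet).eq_of_isMinOn hPmin hmin hP hx

theorem IsOptimal.exists_isSaddlePoint {P : Power nb} (hP : N.IsOptimal m P)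
    (hthr : ∀ e : N.Edge, 0 < N.thr e.1.1 e.1.2) : ∃ μ, N.IsSaddlePoint m P μ := by
  obtain ⟨hx, hmin⟩ := (isOptimal_iff P).1 hP
  obtain ⟨y, hy⟩ := ConvexProgram.exists_isSaddlePoint_of_isMinOn hx hmin
    (isQualified_program hthr _)
  obtain ⟨μ, rfl⟩ := N.multiplierEquiv.surjective y
  exact ⟨μ, (N.isSaddlePoint_stateEquiv_iff m P μ).1 hy⟩

theorem IsSolution.isCaratheodorySolution {z : ℝ → N.State} (hz : N.IsSolution m z) :
    IsCaratheodorySolution (N.program m).saddleField {w | 0 ≤ w.snd.ofLp} (N.stateEquiv ∘ z) :=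
  (show IsCaratheodorySolution (N.field m) {w | 0 ≤ w.2} z from
    ⟨hz.absCont, hz.nonneg, hz.hasDeriv⟩).map N.stateEquiv.toContinuousLinearMap
    (fun w hw => (N.nonneg_multiplierEquiv_iff w.2).2 hw) fun w _ => N.stateEquiv_field m w

theorem IsSaddlePoint.exists_forall_dist_lt {P : Power nb} {μ : N.Multiplier}
    (h : N.IsSaddlePoint m P μ) {ε : ℝ} (hε : 0 < ε) :
    ∃ δ > 0, ∀ z, N.IsSolution m z → dist (z 0) (P, μ) < δ →
      ∀ t, 0 ≤ t → dist (z t) (P, μ) < ε := by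
  obtain ⟨η, hη, hback⟩ := Metric.continuousAt_iff.1
    (N.stateEquiv.symm.continuous.continuousAt (x := N.stateEquiv (P, μ))) ε hε
  obtain ⟨δ, hδ, hforth⟩ := Metric.continuousAt_iff.1
    (N.stateEquiv.continuous.continuousAt (x := (P, μ))) η hη
  refine ⟨δ, hδ, fun z hz h0 t ht => ?_⟩
  have hanti := ((N.isSaddlePoint_stateEquiv_iff m P μ).2 h).antitoneOn_dist
    hz.isCaratheodorySolution
  simpa using hback ((hanti self_mem_Ici ht ht).trans_lt (hforth h0))

theorem IsSaddlePoint.exists_tendsto {P : Power nb} {μ : N.Multiplier}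
    (h : N.IsSaddlePoint m P μ) (hW : ∀ i, N.W i ≠ 0) {z : ℝ → N.State} (hz : N.IsSolution m z) :
    ∃ ν, N.IsSaddlePoint m P ν ∧ Tendsto z atTop (𝓝 (P, ν)) := by
  obtain ⟨w', hw', hfst, hlim⟩ := ((N.isSaddlePoint_stateEquiv_iff m P μ).2 h).exists_tendsto
    (strictConvexOn_program_objective m hW) hz.isCaratheodorySolution
  obtain ⟨⟨P', ν⟩, rfl⟩ := N.stateEquiv.surjective w'
  obtain rfl : P' = P := congrArg WithLp.ofLp hfst
  refine ⟨ν, (N.isSaddlePoint_stateEquiv_iff m P' ν).1 hw', ?_⟩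
  simpa [Function.comp_def] using (N.stateEquiv.symm.continuous.tendsto _).comp hlim

end PowerNetwork

theorem proposition7 {nb n : ℕ} (N : PowerNetwork nb n) (m : ℕ) (hm : 2 ≤ m)
    (hW : ∀ i, N.W i ≠ 0)
    (hthr : ∀ e : N.Edge, 0 < N.thr e.1.1 e.1.2)
    (hfeas : (N.feasible m).Nonempty) :
    ∃ Pstar : PowerNetwork.Power nb,
      (∀ P, N.IsOptimal m P ↔ P = Pstar) ∧
      (∃ μ, N.IsSaddlePoint m Pstar μ) ∧
      (∀ μ, N.IsSaddlePoint m Pstar μ → ∀ ε > 0, ∃ δ > 0, ∀ z, N.IsSolution m z →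
        dist (z 0) (Pstar, μ) < δ → ∀ t, 0 ≤ t → dist (z t) (Pstar, μ) < ε) ∧
      ∀ z, N.IsSolution m z →
        ∃ μ, N.IsSaddlePoint m Pstar μ ∧ Tendsto z atTop (𝓝 (Pstar, μ)) := by
  obtain ⟨Pstar, hopt⟩ := PowerNetwork.exists_forall_isOptimal_iff_eq hW hfeas
  obtain ⟨μ, hμ⟩ := ((hopt Pstar).2 rfl).exists_isSaddlePoint hthr
  exact ⟨Pstar, hopt, ⟨μ, hμ⟩, fun _ hν _ hε => hν.exists_forall_dist_lt hε,
    fun _ hz => hμ.exists_tendsto hW hz⟩
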